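/- Let $G$ be a finite connected graph (loops and parallel edges allowed) with edge set $E$. The cographic matroid $M^\perp(G)$ is the matroid on $E$ in which $A\subseteq E$ is independent if and only if $G\setminus A$ (the graph obtained by deleting the edges in $A$ and keeping all vertices) is connected. For a length function $\ell:E\to\mathbb{R}_{>0}$ let $\Gamma=(G,\ell)$ be the metric graph obtained by giving each edge $e$ the length $\ell(e)$. A divisor on $\Gamma$ is an element of the free abelian group $\mathrm{Div}(\Gamma)$ on the points of $\Gamma$. A piecewise $\mathbb{Z}$-linear function on $\Gamma$ is a continuous function $f:\Gamma\to\mathbb{R}$ that is piecewise linear, with finitely many pieces and integer slopes, on each edge. Its divisor $\mathrm{div}(f)$ has, at each point $x$, coefficient equal to minus the sum of the outgoing slopes of $f$ at $x$. Let $\mathrm{Pic}(\Gamma)$ be the quotient of $\mathrm{Div}(\Gamma)$ by the divisors of piecewise $\mathbb{Z}$-linear functions, let $[D]$ be the class of $D$, let $\mathrm{Pic}^d(\Gamma)$ be the set of classes of degree $d$, and let $\mathrm{Eff}^d(\Gamma)\subseteq\mathrm{Pic}^d(\Gamma)$ be the set of classes of effective divisors of degree $d$. The torsion packet of $[D]\in\mathrm{Eff}^d(\Gamma)$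 is the set of all $[D']\in \mathrm{Eff}^d(\Gamma)$ with $n[D'-D]=0$ for some integer $n>0$. For edges $e_1,\dots,e_k$ let $$\mathrm{Eff}(e_1,\dots,e_k)^\circ=\{[x_1+\cdots+x_k] : x_i \text{ in the interior of } e_i\}\subseteq \mathrm{Pic}^k(\Gamma).$$ **Proposition.** Let $e_1,\dots,e_k$ be edges of $G$ (repetitions allowed) such that the set $\{e_1,\dots,e_k\}$ is independent in $M^\perp(G)$ and the closure of $\{e_1,\dots,e_k\}$ in the matroid $M^\perp(G)$ spans an acyclic subgraph of $G$, i.e. contains the edge set of no cycle of $G$. Then for very general edge lengths $\ell$, any two distinct divisor classes in $\mathrm{Eff}(e_1,\dots,e_k)^\circ$ lie in distinct torsion packets. Here "for very general edge lengths" means: there is a countable family of nonzero polynomials in $\mathbb{R}[x_e : e\in E]$ such that the claim holds for every $\ell\in(\mathbb{R}_{>0})^E$ at which none of these polynomials vanishes. -/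

import Mathlib

/-! ## Oriented multigraphs -/

/-- An oriented graph with vertex set `V` and edge set `E`. Loops and parallel edges are allowed.
The edge `a` runs from `tail a` to `head a`. -/
structure OrientedGraph (V E : Type*) where
  tail : E → V
  head : E → V

namespace OrientedGraph

variable {V E : Type*} (G : OrientedGraph V E)

/-- The edge `a` lies between the vertices `u` and `v`. -/
def Link (a : E) (u v : V) : Prop :=
  (G.tail a = u ∧ G.head a = v) ∨ (G.tail a = v ∧ G.head a = u)

/-- `u` and `v` are joined by a walk that only uses edges in `A`. -/
def Reach (A : Set E) : V → V → Prop :=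
  Relation.ReflTransGen fun u v => ∃ a ∈ A, G.Link a u v

/-- The subgraph `G|A`, with all the vertices of `G` and with edge set `A`, is connected. -/
def ConnectedOn (A : Set E) : Prop :=
  Nonempty V ∧ ∀ u v, G.Reach A u v

/-- `G` is connected. -/
def Connected : Prop := G.ConnectedOn Set.univ

/-- `C` is the edge set of a cycle of `G`, i.e. of a subgraph homeomorphic to a circle: for some
`n ≥ 1` it consists of `n` distinct edges running cyclically through `n` distinct vertices. -/
def IsCycle (C : Set E) : Prop :=
  ∃ n : ℕ, 0 < n ∧ ∃ (v : ZMod n → V) (a : ZMod n → E),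
    Function.Injective v ∧ Function.Injective a ∧
    (∀ i, G.Link (a i) (v i) (v (i + 1))) ∧ C = Set.range a

/-- The edges in `A` span an acyclic subgraph. -/
def IsAcyclic (A : Set E) : Prop := ∀ C ⊆ A, ¬ G.IsCycle C

variable {G}

theorem Link.symm {a : E} {u v : V} (h : G.Link a u v) : G.Link a v u := Or.symm h

theorem Reach.symm {A : Set E} {u v : V} (h : G.Reach A u v) : G.Reach A v u := by
  induction h with
  | refl => exact .refl
  | tail _ h ih =>
    obtain ⟨a, ha, hl⟩ := h
    exact Relation.ReflTransGen.head ⟨a, ha, hl.symm⟩ ih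

theorem Reach.trans {A : Set E} {u v w : V} (h : G.Reach A u v) (h' : G.Reach A v w) :
    G.Reach A u w := Relation.ReflTransGen.trans h h'

theorem Reach.mono {A B : Set E} (hAB : A ⊆ B) {u v : V} (h : G.Reach A u v) :
    G.Reach B u v :=
  Relation.ReflTransGen.mono (fun _ _ ⟨a, ha, hl⟩ => ⟨a, hAB ha, hl⟩) _ _ h

theorem reach_of_mem {A : Set E} {a : E} (ha : a ∈ A) : G.Reach A (G.tail a) (G.head a) :=
  Relation.ReflTransGen.single ⟨a, ha, Or.inl ⟨rfl, rfl⟩⟩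

/-- A walk either avoids a given edge, or passes through both of its ends. -/
theorem Reach.avoid {A : Set E} (x : E) {u v : V} (h : G.Reach A u v) :
    G.Reach (A \ {x}) u v ∨
    (G.Reach (A \ {x}) u (G.tail x) ∧ G.Reach (A \ {x}) (G.head x) v) ∨
    (G.Reach (A \ {x}) u (G.head x) ∧ G.Reach (A \ {x}) (G.tail x) v) := by
  induction h with
  | refl => exact Or.inl .refl
  | @tail v w _ h ih =>
    obtain ⟨a, ha, hl⟩ := h
    by_cases hax : a = x
    · subst hax
      rcases hl with ⟨rfl, rfl⟩ | ⟨rfl, rfl⟩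
      · rcases ih with h | ⟨h, -⟩ | ⟨h, -⟩
        · exact Or.inr (Or.inl ⟨h, .refl⟩)
        · exact Or.inr (Or.inl ⟨h, .refl⟩)
        · exact Or.inl h
      · rcases ih with h | ⟨h, -⟩ | ⟨h, -⟩
        · exact Or.inr (Or.inr ⟨h, .refl⟩)
        · exact Or.inl h
        · exact Or.inr (Or.inr ⟨h, .refl⟩)
    · have hs : G.Reach (A \ {x}) v w := Relation.ReflTransGen.single ⟨a, ⟨ha, hax⟩, hl⟩
      rcases ih with h | ⟨h, h'⟩ | ⟨h, h'⟩
      · exact Or.inl (h.trans hs)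
      · exact Or.inr (Or.inl ⟨h, h'.trans hs⟩)
      · exact Or.inr (Or.inr ⟨h, h'.trans hs⟩)

/-- Deleting an edge whose ends stay joined keeps a graph connected. -/
theorem ConnectedOn.diff_singleton {A : Set E} (h : G.ConnectedOn A) {z : E}
    (hz : G.Reach (A \ {z}) (G.tail z) (G.head z)) : G.ConnectedOn (A \ {z}) := by
  refine ⟨h.1, fun u v => ?_⟩
  rcases (h.2 u v).avoid z with h | ⟨h, h'⟩ | ⟨h, h'⟩
  · exact h
  · exact h.trans (hz.trans h')
  · exact h.trans (hz.symm.trans h')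

theorem ConnectedOn.mono {A B : Set E} (hAB : A ⊆ B) (h : G.ConnectedOn A) :
    G.ConnectedOn B := ⟨h.1, fun u v => (h.2 u v).mono hAB⟩

/-- If every edge in `X` is a bridge of `G|A`, then the ends of any other edge `z` of `G|A` that
is not a bridge stay joined after deletion of `z` and `X`. -/
theorem reach_diff_of_bridges {A : Set E} (hA : G.ConnectedOn A) {z : E} (hz : z ∈ A)
    (hzA : G.ConnectedOn (A \ {z})) {X : Set E} (hX : X.Finite) (hzX : z ∉ X)
    (hb : ∀ x ∈ X, ¬ G.ConnectedOn (A \ {x})) :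
    G.Reach ((A \ {z}) \ X) (G.tail z) (G.head z) := by
  induction X, hX using Set.Finite.induction_on with
  | empty => simpa using hzA.2 _ _
  | @insert x X _ _ ih =>
    have h := ih (fun h => hzX (Set.mem_insert_of_mem _ h))
      (fun y hy => hb y (Set.mem_insert_of_mem _ hy))
    have hne : z ≠ x := fun h => hzX (h ▸ Set.mem_insert _ _)
    have heq : (A \ {z}) \ insert x X = ((A \ {z}) \ X) \ {x} := by
      ext y; simp only [Set.mem_sdiff, Set.mem_insert_iff, Set.mem_singleton_iff]; tauto
    have hsub : ((A \ {z}) \ X) \ {x} ⊆ A \ {x} := fun y hy => ⟨hy.1.1.1, hy.2⟩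
    have hzr : G.Reach (A \ {x}) (G.tail z) (G.head z) := reach_of_mem ⟨hz, hne⟩
    rw [heq]
    rcases h.avoid x with h | ⟨h, h'⟩ | ⟨h, h'⟩
    · exact h
    · refine absurd (hA.diff_singleton ?_) (hb x (Set.mem_insert _ _))
      exact (h.mono hsub).symm.trans (hzr.trans (h'.mono hsub).symm)
    · refine absurd (hA.diff_singleton ?_) (hb x (Set.mem_insert _ _))
      exact (h'.mono hsub).trans (hzr.symm.trans (h.mono hsub))

variable (G)

/-- The cographic matroid of a finite connected graph, by its independent sets: `A` is independent
if and only if `G \ A` is connected. Its bases are the complements of the spanning trees. -/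
def cographicMatroid [Finite E] (hG : G.Connected) : Matroid E :=
  (IndepMatroid.ofBdd Set.univ (fun A => G.ConnectedOn Aᶜ)
    (by rw [Set.compl_empty]; exact hG)
    (fun _ _ hJ hIJ => hJ.mono (Set.compl_subset_compl.2 hIJ))
    (by
      intro I B hI hImax hBmax
      by_contra! hcon
      obtain ⟨z, hzI, hz⟩ : ∃ z, z ∉ I ∧ G.ConnectedOn (insert z I)ᶜ := by
        by_contra! h
        refine hImax ⟨hI, fun J hJ hIJ => ?_⟩
        intro y hy
        by_contra hyI
        exact h y hyI (hJ.mono (Set.compl_subset_compl.2 (Set.insert_subset hy hIJ)))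
      have hins : ∀ (y : E) (J : Set E), (insert y J)ᶜ = Jᶜ \ {y} := by
        intro y J
        ext w; simp only [Set.mem_compl_iff, Set.mem_insert_iff, Set.mem_sdiff,
          Set.mem_singleton_iff]; tauto
      have hzB : z ∉ B := fun h => hcon z ⟨h, hzI⟩ hz
      have hr : G.Reach ((Iᶜ \ {z}) \ (B \ I)) (G.tail z) (G.head z) :=
        reach_diff_of_bridges hI hzI (hins z I ▸ hz) (Set.toFinite _) (fun h => hzB h.1)
          (fun x hx => hins x I ▸ hcon x hx)
      have hBz : G.ConnectedOn (insert z B)ᶜ := by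
        rw [hins]
        refine hBmax.1.diff_singleton (hr.mono ?_)
        intro y hy
        exact ⟨fun hyB => hy.2 ⟨hyB, hy.1.1⟩, hy.1.2⟩
      exact hzB (hBmax.2 hBz (Set.subset_insert z B) (Set.mem_insert z B)))
    (fun _ _ => Set.subset_univ _)
    ⟨(Set.univ : Set E).ncard, fun I _ => by
      rw [(Set.toFinite _).cast_ncard_eq]; exact Set.encard_le_encard (Set.subset_univ I)⟩).matroid

theorem cographicMatroid_indep_iff [Finite E] (hG : G.Connected) {A : Set E} :
    (G.cographicMatroid hG).Indep A ↔ G.ConnectedOn Aᶜ := Iff.rfl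

end OrientedGraph

/-! ## Metric graphs -/

/-- A (model of a) metric graph: a connected graph with positive edge lengths. -/
structure MetricGraph (V E : Type*) extends OrientedGraph V E where
  connected : toOrientedGraph.Connected
  length : E → ℝ
  length_pos : ∀ a, 0 < length a

/-- The metric graph `(G, l)`, for a connected graph `G` and positive edge lengths `l`. -/
def OrientedGraph.withLengths {V E : Type*} (G : OrientedGraph V E) (hG : G.Connected)
    (l : {l : E → ℝ | ∀ a, 0 < l a}) : MetricGraph V E :=
  { G with connected := hG, length := l.1, length_pos := l.2 }

namespace MetricGraph

variable {V E : Type*} (Γ : MetricGraph V E)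

/-- The points of the metric graph: the vertices, and for each edge `a` the points of its
interior, at distance `t` from the tail of `a` along `a`, for `0 < t < length a`. -/
inductive Point : Type _
  | vertex (v : V) : Point
  | inner (a : E) (t : ℝ) (ht : t ∈ Set.Ioo 0 (Γ.length a)) : Point

open Classical in
/-- The parametrization `[0, length a] → Γ` of the edge `a` by arc length from its tail to its
head (extended to `ℝ` by a constant on each side). -/
noncomputable def edge (a : E) (t : ℝ) : Γ.Point :=
  if t ≤ 0 then .vertex (Γ.tail a)
  else if h : t ∈ Set.Ioo 0 (Γ.length a) then .inner a t h
  else .vertex (Γ.head a)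

/-- The topology of the metric graph: the intervals `[0, length a]`, glued at the vertices. -/
noncomputable instance : TopologicalSpace Γ.Point :=
  ⨆ a : E, TopologicalSpace.coinduced
    (fun t : Set.Icc (0 : ℝ) (Γ.length a) => Γ.edge a t) inferInstance

/-- `f` is piecewise `ℤ`-linear: it is continuous, and each edge has a finite set `S` of break
points such that `f` is affine with integer slope on every segment whose interior avoids `S`. -/
def IsPiecewiseZLinear (f : Γ.Point → ℝ) : Prop :=
  Continuous f ∧ ∀ a : E, ∃ S : Set ℝ, S.Finite ∧
    ∀ p q, 0 ≤ p → p ≤ q → q ≤ Γ.length a → Disjoint S (Set.Ioo p q) →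
      ∃ m : ℤ, ∀ t ∈ Set.Icc p q, f (Γ.edge a t) = f (Γ.edge a p) + m * (t - p)

/-- The slope of `f` at the point `edge a t` in the direction of the head of `a`. -/
noncomputable def slopeToHead (f : Γ.Point → ℝ) (a : E) (t : ℝ) : ℝ :=
  derivWithin (fun s => f (Γ.edge a s)) (Set.Ioi t) t

/-- The slope of `f` at the point `edge a t` in the direction of the tail of `a`. -/
noncomputable def slopeToTail (f : Γ.Point → ℝ) (a : E) (t : ℝ) : ℝ :=
  - derivWithin (fun s => f (Γ.edge a s)) (Set.Iio t) t

open Classical in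
/-- The coefficient at a point of the divisor of a piecewise linear function: minus the sum of the
outgoing slopes. -/
noncomputable def divCoeff [Fintype E] (f : Γ.Point → ℝ) : Γ.Point → ℝ
  | .vertex v =>
      - ((∑ a : E, if Γ.tail a = v then Γ.slopeToHead f a 0 else 0) +
         (∑ a : E, if Γ.head a = v then Γ.slopeToTail f a (Γ.length a) else 0))
  | .inner a t _ => - (Γ.slopeToHead f a t + Γ.slopeToTail f a t)

/-- The group `Div(Γ)` of divisors. -/
abbrev Divisor : Type _ := Γ.Point →₀ ℤ

/-- The degree of a divisor. -/
def degree (D : Γ.Divisor) : ℤ := D.sum fun _ n => n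

variable {Γ}

theorem IsPiecewiseZLinear.zero : Γ.IsPiecewiseZLinear 0 :=
  ⟨continuous_const, fun _ => ⟨∅, Set.finite_empty, fun _ _ _ _ _ _ => ⟨0, fun _ _ => by simp⟩⟩⟩

theorem IsPiecewiseZLinear.neg {f : Γ.Point → ℝ} (hf : Γ.IsPiecewiseZLinear f) :
    Γ.IsPiecewiseZLinear (-f) := by
  refine ⟨hf.1.neg, fun a => ?_⟩
  obtain ⟨S, hS, h⟩ := hf.2 a
  refine ⟨S, hS, fun p q hp hpq hq hd => ?_⟩
  obtain ⟨m, hm⟩ := h p q hp hpq hq hd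
  refine ⟨-m, fun t ht => ?_⟩
  simp only [Pi.neg_apply, hm t ht]
  push_cast
  ring

theorem IsPiecewiseZLinear.add {f g : Γ.Point → ℝ} (hf : Γ.IsPiecewiseZLinear f)
    (hg : Γ.IsPiecewiseZLinear g) : Γ.IsPiecewiseZLinear (f + g) := by
  refine ⟨hf.1.add hg.1, fun a => ?_⟩
  obtain ⟨S, hS, h⟩ := hf.2 a
  obtain ⟨T, hT, h'⟩ := hg.2 a
  refine ⟨S ∪ T, hS.union hT, fun p q hp hpq hq hd => ?_⟩
  rw [Set.disjoint_union_left] at hd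
  obtain ⟨m, hm⟩ := h p q hp hpq hq hd.1
  obtain ⟨n, hn⟩ := h' p q hp hpq hq hd.2
  refine ⟨m + n, fun t ht => ?_⟩
  simp only [Pi.add_apply, hm t ht, hn t ht]
  push_cast
  ring

theorem IsPiecewiseZLinear.differentiableWithinAt_Ioi {f : Γ.Point → ℝ}
    (hf : Γ.IsPiecewiseZLinear f) (a : E) {t : ℝ} (h0 : 0 ≤ t) (h1 : t < Γ.length a) :
    DifferentiableWithinAt ℝ (fun s => f (Γ.edge a s)) (Set.Ioi t) t := by
  obtain ⟨S, hS, h⟩ := hf.2 a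
  have hmem : (S \ {t})ᶜ ∈ nhds t :=
    (hS.subset Set.sdiff_subset).isClosed.isOpen_compl.mem_nhds (by simp)
  obtain ⟨q, hq, hqS⟩ := mem_nhdsGE_iff_exists_mem_Ioc_Ico_subset h1 |>.1
    (mem_nhdsWithin_of_mem_nhds hmem)
  obtain ⟨m, hm⟩ := h t q h0 hq.1.le hq.2 (by
    rw [Set.disjoint_left]
    intro s hs hs'
    exact hqS ⟨hs'.1.le, hs'.2⟩ ⟨hs, hs'.1.ne'⟩)
  have hd : DifferentiableWithinAt ℝ (fun s : ℝ => f (Γ.edge a t) + m * (s - t)) (Set.Ioi t) t := by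
    fun_prop
  refine hd.congr_of_eventuallyEq ?_ (by simp)
  filter_upwards [Ioc_mem_nhdsGT hq.1] with s hs
  exact hm s ⟨hs.1.le, hs.2⟩

theorem IsPiecewiseZLinear.differentiableWithinAt_Iio {f : Γ.Point → ℝ}
    (hf : Γ.IsPiecewiseZLinear f) (a : E) {t : ℝ} (h0 : 0 < t) (h1 : t ≤ Γ.length a) :
    DifferentiableWithinAt ℝ (fun s => f (Γ.edge a s)) (Set.Iio t) t := by
  obtain ⟨S, hS, h⟩ := hf.2 a
  have hmem : (S \ {t})ᶜ ∈ nhds t :=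
    (hS.subset Set.sdiff_subset).isClosed.isOpen_compl.mem_nhds (by simp)
  obtain ⟨p, hp, hpS⟩ := mem_nhdsLE_iff_exists_mem_Ico_Ioc_subset h0 |>.1
    (mem_nhdsWithin_of_mem_nhds hmem)
  obtain ⟨m, hm⟩ := h p t hp.1 hp.2.le h1 (by
    rw [Set.disjoint_left]
    intro s hs hs'
    exact hpS ⟨hs'.1, hs'.2.le⟩ ⟨hs, hs'.2.ne⟩)
  have hd : DifferentiableWithinAt ℝ (fun s : ℝ => f (Γ.edge a p) + m * (s - p)) (Set.Iio t) t := by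
    fun_prop
  refine hd.congr_of_eventuallyEq ?_ (hm t ⟨hp.2.le, le_rfl⟩)
  filter_upwards [Ico_mem_nhdsLT hp.2] with s hs
  exact hm s ⟨hs.1, hs.2.le⟩

theorem slopeToHead_add {f g : Γ.Point → ℝ} (hf : Γ.IsPiecewiseZLinear f)
    (hg : Γ.IsPiecewiseZLinear g) (a : E) {t : ℝ} (h0 : 0 ≤ t) (h1 : t < Γ.length a) :
    Γ.slopeToHead (f + g) a t = Γ.slopeToHead f a t + Γ.slopeToHead g a t :=
  derivWithin_fun_add (hf.differentiableWithinAt_Ioi a h0 h1)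
    (hg.differentiableWithinAt_Ioi a h0 h1)

theorem slopeToTail_add {f g : Γ.Point → ℝ} (hf : Γ.IsPiecewiseZLinear f)
    (hg : Γ.IsPiecewiseZLinear g) (a : E) {t : ℝ} (h0 : 0 < t) (h1 : t ≤ Γ.length a) :
    Γ.slopeToTail (f + g) a t = Γ.slopeToTail f a t + Γ.slopeToTail g a t := by
  have h := derivWithin_fun_add (hf.differentiableWithinAt_Iio a h0 h1)
    (hg.differentiableWithinAt_Iio a h0 h1)
  simp only [slopeToTail, Pi.add_apply, h]
  ring

theorem slopeToHead_neg (f : Γ.Point → ℝ) (a : E) (t : ℝ) :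
    Γ.slopeToHead (-f) a t = - Γ.slopeToHead f a t :=
  derivWithin.fun_neg

theorem slopeToTail_neg (f : Γ.Point → ℝ) (a : E) (t : ℝ) :
    Γ.slopeToTail (-f) a t = - Γ.slopeToTail f a t :=
  congrArg Neg.neg derivWithin.fun_neg

theorem divCoeff_zero [Fintype E] (x : Γ.Point) : Γ.divCoeff 0 x = 0 := by
  cases x <;> simp [divCoeff, slopeToHead, slopeToTail]

theorem divCoeff_neg [Fintype E] (f : Γ.Point → ℝ) (x : Γ.Point) :
    Γ.divCoeff (-f) x = - Γ.divCoeff f x := by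
  cases x with
  | vertex v =>
    simp only [divCoeff, slopeToHead_neg, slopeToTail_neg]
    rw [neg_inj, neg_add, ← Finset.sum_neg_distrib, ← Finset.sum_neg_distrib]
    congr 1 <;> refine Finset.sum_congr rfl fun a _ => ?_ <;> split_ifs <;> simp
  | inner a t ht => simp only [divCoeff, slopeToHead_neg, slopeToTail_neg]; ring

theorem divCoeff_add [Fintype E] {f g : Γ.Point → ℝ} (hf : Γ.IsPiecewiseZLinear f)
    (hg : Γ.IsPiecewiseZLinear g) (x : Γ.Point) :
    Γ.divCoeff (f + g) x = Γ.divCoeff f x + Γ.divCoeff g x := by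
  cases x with
  | vertex v =>
    simp only [divCoeff, slopeToHead_add hf hg _ le_rfl (Γ.length_pos _),
      slopeToTail_add hf hg _ (Γ.length_pos _) le_rfl, ite_add_zero, Finset.sum_add_distrib]
    ring
  | inner a t ht =>
    simp only [divCoeff, slopeToHead_add hf hg a ht.1.le ht.2,
      slopeToTail_add hf hg a ht.1 ht.2.le]
    ring

variable (Γ)

/-- The group of principal divisors: the divisors of piecewise `ℤ`-linear functions. -/
noncomputable def principal [Fintype E] : AddSubgroup Γ.Divisor where
  carrier := {D | ∃ f, Γ.IsPiecewiseZLinear f ∧ ∀ x, (D x : ℝ) = Γ.divCoeff f x}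
  zero_mem' := ⟨0, .zero, fun x => by simp [divCoeff_zero]⟩
  add_mem' := by
    rintro D D' ⟨f, hf, h⟩ ⟨g, hg, h'⟩
    exact ⟨f + g, hf.add hg, fun x => by simp [divCoeff_add hf hg, h, h']⟩
  neg_mem' := by
    rintro D ⟨f, hf, h⟩
    exact ⟨-f, hf.neg, fun x => by simp [divCoeff_neg, h]⟩

/-- The Picard group of `Γ`, the group of divisors modulo linear equivalence. -/
noncomputable abbrev Pic [Fintype E] : Type _ := Γ.Divisor ⧸ Γ.principal

/-- The class of a divisor in the Picard group. -/
noncomputable def divisorClass [Fintype E] (D : Γ.Divisor) : Γ.Pic := QuotientAddGroup.mk D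

/-- The set `Eff^d(Γ)` of effective divisor classes of degree `d`. -/
def eff [Fintype E] (d : ℕ) : Set Γ.Pic :=
  {c | ∃ D : Γ.Divisor, 0 ≤ D ∧ Γ.degree D = d ∧ Γ.divisorClass D = c}

/-- The torsion classes in the Jacobian of `Γ`, i.e. in the group of classes of degree `0`. -/
def jacTorsion [Fintype E] : Set Γ.Pic :=
  {c | (∃ D : Γ.Divisor, Γ.degree D = 0 ∧ Γ.divisorClass D = c) ∧ ∃ n : ℕ, 0 < n ∧ n • c = 0}

/-- The degree `d` torsion packet of `c`. -/
def torsionPacket [Fintype E] (d : ℕ) (c : Γ.Pic) : Set Γ.Pic :=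
  {c' | c' ∈ Γ.eff d ∧ c' - c ∈ Γ.jacTorsion}

/-- The interior of the edge `a`. -/
def edgeInterior (a : E) : Set Γ.Point := Γ.edge a '' Set.Ioo 0 (Γ.length a)

/-- The open cell `Eff(e₁, …, eₖ)°` of the classes `[x₁ + ⋯ + xₖ]` with `xᵢ` in the interior
of `eᵢ`. -/
def effOpenCell [Fintype E] {k : ℕ} (e : Fin k → E) : Set Γ.Pic :=
  {c | ∃ x : Fin k → Γ.Point, (∀ i, x i ∈ Γ.edgeInterior (e i)) ∧
    c = Γ.divisorClass (∑ i, Finsupp.single (x i) 1)}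

end MetricGraph

/-! ## Very general points -/

/-- A subset of `ℝⁿ` is very general if its complement is contained in a countable union of zero
sets of nonzero polynomials. -/
def IsVeryGeneral {ι : Type*} (S : Set (ι → ℝ)) : Prop :=
  ∃ F : Set (MvPolynomial ι ℝ), F.Countable ∧ (∀ p ∈ F, p ≠ 0) ∧
    Sᶜ ⊆ ⋃ p ∈ F, {x | MvPolynomial.eval x p = 0}

/-- `P` holds for a very general point of the parameter space `D`: it holds on `D ∩ S` for some
very general set `S`. -/
def ForVeryGeneral {ι : Type*} (D : Set (ι → ℝ)) (P : D → Prop) : Prop :=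
  ∃ S : Set (ι → ℝ), IsVeryGeneral S ∧ ∀ x : D, (x : ι → ℝ) ∈ S → P x

namespace OrientedGraph

/-! ### Circulations, potentials and the cographic closure -/

variable {V E : Type*} {G : OrientedGraph V E}

/-- If `out` chooses for every vertex of a finite nonempty set an edge from it to a vertex of the set,
then the chosen edges contain a cycle. -/
theorem exists_isCycle_of_out {W : Type*} [Finite W] [Nonempty W] {B : Set E} (vert : W → V)
    (hvert : Function.Injective vert) (out : W → E) (hout : Function.Injective out)
    (hB : ∀ w, out w ∈ B) (next : W → W)
    (hlink : ∀ w, G.Link (out w) (vert w) (vert (next w))) :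
    ∃ C ⊆ B, G.IsCycle C := by
  obtain ⟨w₀⟩ := ‹Nonempty W›
  -- `next` need not be injective, so `w₀` itself may fail to be periodic; a repeated iterate is.
  obtain ⟨i, j, hij, h⟩ := Finite.exists_ne_map_eq_of_infinite fun i : ℕ => next^[i] w₀
  wlog hlt : i < j generalizing i j
  · exact this j i hij.symm h.symm (by omega)
  have hper : next^[i] w₀ ∈ Function.periodicPts next := by
    refine Function.mk_mem_periodicPts (n := j - i) (by omega) ?_
    change next^[j - i] (next^[i] w₀) = next^[i] w₀
    rw [← Function.iterate_add_apply, Nat.sub_add_cancel hlt.le]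
    exact h.symm
  set w := next^[i] w₀
  set n := Function.minimalPeriod next w
  have hpos : 0 < n := Function.minimalPeriod_pos_of_mem_periodicPts hper
  have : NeZero n := ⟨hpos.ne'⟩
  have hinj : Function.Injective fun i : ZMod n => next^[i.val] w := fun i i' h =>
    ZMod.val_injective n
      (Function.iterate_injOn_Iio_minimalPeriod (ZMod.val_lt i) (ZMod.val_lt i') h)
  have hsucc : ∀ i : ZMod n, next^[(i + 1).val] w = next (next^[i.val] w) := by
    intro i
    rw [← Function.iterate_succ_apply' next, ZMod.val_add, ZMod.val_one_eq_one_mod, Nat.add_mod_mod]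
    exact Function.iterate_mod_minimalPeriod_eq
  refine ⟨Set.range fun i : ZMod n => out (next^[i.val] w), ?_, n, hpos,
    fun i => vert (next^[i.val] w), fun i => out (next^[i.val] w), hvert.comp hinj,
    hout.comp hinj, fun i => ?_, rfl⟩
  · rintro _ ⟨i, rfl⟩
    exact hB _
  · simp only [hsucc]
    exact hlink _

/-- An integral circulation that is supported on an acyclic subgraph vanishes. -/
theorem IsAcyclic.circulation_eq_zero [Finite V] [Fintype E] [DecidableEq V] {B : Set E}
    (hB : G.IsAcyclic B) (s : E → ℤ) (hs : ∀ a ∉ B, s a = 0)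
    (hcirc : ∀ v, ∑ a, (if G.tail a = v then s a else 0) =
      ∑ a, (if G.head a = v then s a else 0)) : s = 0 := by
  by_contra hne
  obtain ⟨a₀, ha₀⟩ := Function.ne_iff.1 hne
  -- Each edge is reoriented so that its flow is positive; the choice on edges with zero flow is
  -- immaterial.
  let src : E → V := fun a => if 0 < s a then G.tail a else G.head a
  let tgt : E → V := fun a => if 0 < s a then G.head a else G.tail a
  have hlink : ∀ a, G.Link a (src a) (tgt a) := by
    intro a
    by_cases h : 0 < s a <;> simp [src, tgt, h, Link]
  -- Flow that enters a vertex must leave it: otherwise every term of the net outflow at `tgt a` is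
  -- nonpositive, and the term of `a` is negative.
  have hleave : ∀ a, s a ≠ 0 → ∃ b, s b ≠ 0 ∧ src b = tgt a := by
    intro a ha
    by_contra! hcon
    have hsum : ∑ b, ((if G.tail b = tgt a then s b else 0) -
        (if G.head b = tgt a then s b else 0)) = 0 := by
      rw [Finset.sum_sub_distrib, hcirc, sub_self]
    have hle : ∀ b ∈ Finset.univ, (if G.tail b = tgt a then s b else 0) -
        (if G.head b = tgt a then s b else 0) ≤ 0 := by
      intro b _
      by_cases hb : s b = 0
      · simp [hb]
      · have h := hcon b hb
        by_cases hp : 0 < s b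
        · simp only [src, hp, if_true] at h
          rw [if_neg h]
          split_ifs <;> omega
        · simp only [src, hp, if_false] at h
          rw [if_neg h]
          split_ifs <;> omega
    have h := (Finset.sum_eq_zero_iff_of_nonpos hle).1 hsum a (Finset.mem_univ a)
    have h' := hcon a ha
    by_cases hp : 0 < s a
    · simp only [src, tgt, hp, if_true] at h h'
      rw [if_neg h'] at h
      omega
    · simp only [src, tgt, hp, if_false, if_true] at h h'
      rw [if_neg h'] at h
      omega
  let W := {v : V // ∃ a, s a ≠ 0 ∧ src a = v}
  have : Nonempty W := ⟨⟨src a₀, a₀, ha₀, rfl⟩⟩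
  choose out hout hsrc using fun w : W => w.2
  have hsrc' : ∀ w, src (out w) = w.1 := hsrc
  obtain ⟨C, hC, hcyc⟩ := exists_isCycle_of_out (G := G) (B := B) (fun w : W => w.1)
    Subtype.val_injective out
    (fun w w' h => Subtype.ext (by rw [← hsrc' w, ← hsrc' w', h]))
    (fun w => by_contra fun h => hout w (hs _ h)) (fun w => ⟨tgt (out w), hleave _ (hout w)⟩)
    (fun w => by have h := hlink (out w); rwa [hsrc'] at h)
  exact hB C hC hcyc

/-- The increment of a potential along a walk is an integral combination of its increments along
the edges that the walk may use. -/
theorem Reach.exists_sub_eq_sum [Fintype E] {A : Set E} {u v : V} (h : G.Reach A u v)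
    (p : V → ℝ) : ∃ z : E → ℤ, (∀ a ∉ A, z a = 0) ∧
      p v - p u = ∑ a, z a * (p (G.head a) - p (G.tail a)) := by
  classical
  induction h with
  | refl => exact ⟨0, by simp, by simp⟩
  | @tail v w _ h ih =>
    obtain ⟨z, hz, hsum⟩ := ih
    obtain ⟨a, ha, hl⟩ := h
    -- `z` counts signed traversals; `c` is `1` or `-1` according to the direction of the last step.
    have key : ∀ c : ℤ, p w - p v = c * (p (G.head a) - p (G.tail a)) → ∃ z : E → ℤ,
        (∀ a ∉ A, z a = 0) ∧ p w - p u = ∑ a, z a * (p (G.head a) - p (G.tail a)) := by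
      intro c hc
      refine ⟨z + Pi.single a c, fun b hb => ?_, ?_⟩
      · have : b ≠ a := fun h => hb (h ▸ ha)
        simp [hz b hb, this]
      · simp only [Pi.add_apply, Int.cast_add, add_mul, Finset.sum_add_distrib, ← hsum]
        rw [Finset.sum_eq_single a (fun b _ hb => by simp [hb]) (by simp), Pi.single_eq_same,
          ← hc]
        ring
    rcases hl with ⟨rfl, rfl⟩ | ⟨rfl, rfl⟩
    · exact key 1 (by simp)
    · exact key (-1) (by push_cast; ring)

/-- If the edge lengths satisfy no integral linear relation and a potential has, on all edges
outside an independent set of the cographic matroid, increments that are integral multiples of the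
edge lengths, then its increments vanish outside the closure of that set. -/
theorem slope_eq_zero_of_notMem_closure [Fintype E] (hG : G.Connected) {A : Set E}
    (hA : (G.cographicMatroid hG).Indep A) {l : E → ℝ}
    (hl : ∀ c : E → ℤ, ∑ a, c a * l a = 0 → c = 0) (p : V → ℝ) (s : E → ℤ)
    (hps : ∀ a ∉ A, p (G.head a) - p (G.tail a) = s a * l a) {a : E}
    (ha : a ∉ (G.cographicMatroid hG).closure A) : s a = 0 := by
  classical
  obtain ⟨hins, haA⟩ := (hA.notMem_closure_iff (Set.mem_univ a)).1 ha
  rw [cographicMatroid_indep_iff] at hins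
  obtain ⟨z, hz, hsum⟩ := (hins.2 (G.tail a) (G.head a)).exists_sub_eq_sum p
  have hza : z a = 0 := hz a (by simp)
  -- The relation from closing up the walk with `a`. Edges of `A`, whose increments are not
  -- controlled, do not enter, since `z` vanishes there.
  have hrel : ∑ b, ((Pi.single a (s a) - z * s : E → ℤ) b : ℝ) * l b = 0 := by
    have h1 : ∑ b, ((Pi.single a (s a) : E → ℤ) b : ℝ) * l b = s a * l a := by
      rw [Finset.sum_eq_single a (fun b _ hb => by simp [hb]) (by simp), Pi.single_eq_same]
    have h2 : ∑ b, (z b : ℝ) * (p (G.head b) - p (G.tail b)) = ∑ b, ((z * s) b : ℤ) * l b := by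
      refine Finset.sum_congr rfl fun b _ => ?_
      by_cases hb : b ∈ A
      · simp [hz b (by simp [hb])]
      · rw [hps b hb, Pi.mul_apply]
        push_cast
        ring
    simp only [Pi.sub_apply, Int.cast_sub, sub_mul, Finset.sum_sub_distrib]
    rw [h1, ← h2, ← hsum, hps a haA, sub_self]
  have h := congrFun (hl _ hrel) a
  simpa [hza] using h

end OrientedGraph

/-! ### Very general edge lengths -/

/-- A very general point satisfies no nontrivial integral linear relation. -/
theorem isVeryGeneral_setOf_linearIndependent (ι : Type*) [Fintype ι] :
    IsVeryGeneral {l : ι → ℝ | ∀ c : ι → ℤ, ∑ i, c i * l i = 0 → c = 0} := by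
  classical
  let P : (ι → ℤ) → MvPolynomial ι ℝ := fun c =>
    ∑ i, MvPolynomial.C (c i : ℝ) * MvPolynomial.X i
  have heval : ∀ (c : ι → ℤ) (l : ι → ℝ), MvPolynomial.eval l (P c) = ∑ i, c i * l i := by
    intro c l
    simp [P]
  -- Countable because `ι` is finite. The forms are nonzero because their values at basis vectors
  -- are their coefficients.
  refine ⟨P '' {c | c ≠ 0}, (Set.to_countable _).image P, ?_, ?_⟩
  · rintro _ ⟨c, hc, rfl⟩ h0
    refine hc (funext fun i => ?_)
    have h := heval c (Pi.single i 1)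
    rw [h0, map_zero, Finset.sum_eq_single i (fun b _ hb => by simp [hb]) (by simp)] at h
    simpa using h.symm
  · intro l hl
    simp only [Set.mem_compl_iff, Set.mem_ofPred_eq, not_forall] at hl
    obtain ⟨c, hsum, hc⟩ := hl
    exact Set.mem_biUnion (Set.mem_image_of_mem P hc) ((heval c l).trans hsum)

/-! ### Slopes of piecewise linear functions on an interval -/

theorem derivWithin_Ioi_eq_of_affine {g : ℝ → ℝ} {t q x c m : ℝ} (htq : t < q)
    (h : ∀ u ∈ Set.Icc t q, g u = c + m * (u - x)) : derivWithin g (Set.Ioi t) t = m := by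
  have hd : HasDerivWithinAt (fun u : ℝ => c + m * (u - x)) m (Set.Ioi t) t := by
    simpa using (((hasDerivAt_id t).sub_const x).const_mul m).const_add c |>.hasDerivWithinAt
  refine (hd.congr_of_eventuallyEq ?_ (h t ⟨le_rfl, htq.le⟩)).derivWithin (uniqueDiffWithinAt_Ioi t)
  filter_upwards [Ioc_mem_nhdsGT htq] with u hu using h u ⟨hu.1.le, hu.2⟩

theorem derivWithin_Iio_eq_of_affine {g : ℝ → ℝ} {t p x c m : ℝ} (hpt : p < t)
    (h : ∀ u ∈ Set.Icc p t, g u = c + m * (u - x)) : derivWithin g (Set.Iio t) t = m := by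
  have hd : HasDerivWithinAt (fun u : ℝ => c + m * (u - x)) m (Set.Iio t) t := by
    simpa using (((hasDerivAt_id t).sub_const x).const_mul m).const_add c |>.hasDerivWithinAt
  refine (hd.congr_of_eventuallyEq ?_ (h t ⟨hpt.le, le_rfl⟩)).derivWithin (uniqueDiffWithinAt_Iio t)
  filter_upwards [Ico_mem_nhdsLT hpt] with u hu using h u ⟨hu.1, hu.2.le⟩

open Filter Topology in
/-- The one-sided derivatives of a piecewise `ℤ`-linear function on `[0, L]` whose slope changes by
`∑ w i`, over the `i` with `τ i = t`, at every interior point `t`. -/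
theorem exists_slope_eq_add_sum {L : ℝ} (hL : 0 < L) {g : ℝ → ℝ}
    (hright : ∀ t ∈ Set.Ico 0 L, ∃ q > t, ∃ m : ℤ, ∀ u ∈ Set.Icc t q, g u = g t + m * (u - t))
    (hleft : ∀ t ∈ Set.Ioc 0 L, ∃ p < t, ∃ m : ℤ, ∀ u ∈ Set.Icc p t, g u = g p + m * (u - p))
    {ι : Type*} [Fintype ι] (w : ι → ℤ) (τ : ι → ℝ)
    (hjump : ∀ t ∈ Set.Ioo 0 L,
      derivWithin g (Set.Ioi t) t - derivWithin g (Set.Iio t) t =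
        ∑ i, if τ i = t then (w i : ℝ) else 0) :
    ∃ s : ℤ, (∀ t ∈ Set.Ico 0 L, derivWithin g (Set.Ioi t) t =
        s + ∑ i, if τ i ≤ t then (w i : ℝ) else 0) ∧
      ∀ t ∈ Set.Ioc 0 L, derivWithin g (Set.Iio t) t =
        s + ∑ i, if τ i < t then (w i : ℝ) else 0 := by
  -- Right slope minus the jumps accumulated so far: locally constant on `[0, L)`, hence constant by
  -- connectedness.
  let ρ : ℝ → ℝ := fun t => derivWithin g (Set.Ioi t) t - ∑ i, if τ i ≤ t then (w i : ℝ) else 0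
  have hρR : ∀ t ∈ Set.Ico 0 L, ∀ᶠ u in 𝓝[>] t, ρ u = ρ t := by
    intro t ht
    obtain ⟨q, hq, m, hm⟩ := hright t ht
    have hτ : ∀ᶠ u in 𝓝[>] t, ∀ i, (τ i ≤ u ↔ τ i ≤ t) := by
      refine eventually_all.2 fun i => ?_
      by_cases hi : τ i ≤ t
      · filter_upwards [self_mem_nhdsWithin] with u hu
        exact iff_of_true (hi.trans (le_of_lt hu)) hi
      · filter_upwards [Ioo_mem_nhdsGT (not_le.1 hi)] with u hu
        exact iff_of_false (not_le.2 hu.2) hi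
    filter_upwards [hτ, Ioo_mem_nhdsGT hq] with u hu huq
    have h1 : derivWithin g (Set.Ioi u) u = m :=
      derivWithin_Ioi_eq_of_affine huq.2 fun v hv => hm v ⟨huq.1.le.trans hv.1, hv.2⟩
    simp only [ρ, h1, derivWithin_Ioi_eq_of_affine hq hm, hu]
  have hρL : ∀ t ∈ Set.Ioc 0 L, ∀ᶠ u in 𝓝[<] t, ρ u =
      derivWithin g (Set.Iio t) t - ∑ i, if τ i < t then (w i : ℝ) else 0 := by
    intro t ht
    obtain ⟨p, hp, m, hm⟩ := hleft t ht
    have hτ : ∀ᶠ u in 𝓝[<] t, ∀ i, (τ i ≤ u ↔ τ i < t) := by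
      refine eventually_all.2 fun i => ?_
      by_cases hi : τ i < t
      · filter_upwards [Ico_mem_nhdsLT hi] with u hu
        exact iff_of_true hu.1 hi
      · filter_upwards [self_mem_nhdsWithin] with u hu
        exact iff_of_false (not_le.2 (lt_of_lt_of_le hu (not_lt.1 hi))) hi
    filter_upwards [hτ, Ioo_mem_nhdsLT hp] with u hu hup
    have h1 : derivWithin g (Set.Ioi u) u = m :=
      derivWithin_Ioi_eq_of_affine hup.2 fun v hv => hm v ⟨hup.1.le.trans hv.1, hv.2⟩
    simp only [ρ, h1, derivWithin_Iio_eq_of_affine hp hm, hu]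
  -- The jump hypothesis makes the values of `ρ` just left of `t` and at `t` agree.
  have hρ : ∀ t ∈ Set.Ioo 0 L, ρ t =
      derivWithin g (Set.Iio t) t - ∑ i, if τ i < t then (w i : ℝ) else 0 := by
    intro t ht
    have hsplit : (∑ i, if τ i ≤ t then (w i : ℝ) else 0) =
        (∑ i, if τ i < t then (w i : ℝ) else 0) + ∑ i, if τ i = t then (w i : ℝ) else 0 := by
      rw [← Finset.sum_add_distrib]
      refine Finset.sum_congr rfl fun i _ => ?_
      rcases lt_trichotomy (τ i) t with h | h | h
      · simp [h, h.le, h.ne]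
      · simp [h]
      · simp [h.not_ge, h.not_gt, h.ne']
    have := hjump t ht
    simp only [ρ, hsplit]
    linarith
  have hconst : ∀ t ∈ Set.Ico 0 L, ρ t = ρ 0 := by
    intro t ht
    refine isPreconnected_Ico.induction₂ (s := Set.Ico (0 : ℝ) L) (fun x y => ρ x = ρ y)
      ?_ ?_ (fun _ _ _ _ => Eq.symm) ht ⟨le_rfl, hL⟩
    · intro x hx
      have hR := hρR x hx
      have hne : ∀ᶠ y in 𝓝[Set.Ico 0 L] x, ρ y = ρ x := by
        rcases hx.1.eq_or_lt with h0 | h0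
        · have hsub : Set.Ico 0 L ⊆ Set.Ici x := fun y hy => h0 ▸ hy.1
          refine Filter.Eventually.filter_mono (nhdsWithin_mono _ hsub) ?_
          rw [← Set.Ioi_insert, nhdsWithin_insert]
          exact Filter.eventually_sup.2 ⟨by simp, hR⟩
        · refine Filter.Eventually.filter_mono nhdsWithin_le_nhds ?_
          rw [← nhdsLT_sup_nhdsGE, ← Set.Ioi_insert, nhdsWithin_insert]
          refine Filter.eventually_sup.2 ⟨?_, Filter.eventually_sup.2 ⟨by simp, hR⟩⟩
          filter_upwards [hρL x ⟨h0, hx.2.le⟩] with y hy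
          rw [hy, hρ x ⟨h0, hx.2⟩]
      filter_upwards [hne] with y hy using hy.symm
    · intro x y z _ _ _ hxy hyz
      exact hxy.trans hyz
  obtain ⟨q, hq, m, hm⟩ := hright 0 ⟨le_rfl, hL⟩
  have hρ0 : ρ 0 = ((m - ∑ i, if τ i ≤ 0 then w i else 0 : ℤ) : ℝ) := by
    simp only [ρ, derivWithin_Ioi_eq_of_affine hq hm]
    push_cast
    rfl
  refine ⟨m - ∑ i, if τ i ≤ 0 then w i else 0, fun t ht => ?_, fun t ht => ?_⟩
  · have := hconst t ht
    rw [← hρ0, ← this]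
    simp only [ρ]
    ring
  -- Comparing with a point just left of `t` also covers `t = L`, where `ρ` is not controlled.
  · obtain ⟨u, hu, hu'⟩ := ((hρL t ht).and (Ioo_mem_nhdsLT ht.1)).exists
    rw [← hρ0, ← hconst u ⟨hu'.1.le, hu'.2.trans_le ht.2⟩, hu]
    ring

/-! ### Functions with divisor `n (D - D')` on a metric graph -/

namespace MetricGraph

variable {V E : Type*} {Γ : MetricGraph V E}

theorem edge_zero (a : E) : Γ.edge a 0 = .vertex (Γ.tail a) := if_pos le_rfl

theorem edge_length (a : E) : Γ.edge a (Γ.length a) = .vertex (Γ.head a) := by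
  simp [edge, (Γ.length_pos a).not_ge]

theorem edge_of_mem (a : E) {t : ℝ} (ht : t ∈ Set.Ioo 0 (Γ.length a)) :
    Γ.edge a t = .inner a t ht := by
  rw [edge, if_neg (not_le.2 ht.1), dif_pos ht]

theorem continuous_edge (a : E) :
    Continuous fun t : Set.Icc (0 : ℝ) (Γ.length a) => Γ.edge a t :=
  continuous_iSup_rng (i := a) continuous_coinduced_rng

theorem IsPiecewiseZLinear.exists_right {f : Γ.Point → ℝ} (hf : Γ.IsPiecewiseZLinear f) (a : E)
    {t : ℝ} (ht : t ∈ Set.Ico 0 (Γ.length a)) :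
    ∃ q > t, ∃ m : ℤ, ∀ u ∈ Set.Icc t q, f (Γ.edge a u) = f (Γ.edge a t) + m * (u - t) := by
  obtain ⟨S, hS, h⟩ := hf.2 a
  have hmem : (S \ {t})ᶜ ∈ nhds t :=
    (hS.subset Set.sdiff_subset).isClosed.isOpen_compl.mem_nhds (by simp)
  obtain ⟨q, hq, hqS⟩ := mem_nhdsGE_iff_exists_mem_Ioc_Ico_subset ht.2 |>.1
    (mem_nhdsWithin_of_mem_nhds hmem)
  exact ⟨q, hq.1, h t q ht.1 hq.1.le hq.2 (Set.disjoint_left.2 fun s hs hs' =>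
    hqS ⟨hs'.1.le, hs'.2⟩ ⟨hs, hs'.1.ne'⟩)⟩

theorem IsPiecewiseZLinear.exists_left {f : Γ.Point → ℝ} (hf : Γ.IsPiecewiseZLinear f) (a : E)
    {t : ℝ} (ht : t ∈ Set.Ioc 0 (Γ.length a)) :
    ∃ p < t, ∃ m : ℤ, ∀ u ∈ Set.Icc p t, f (Γ.edge a u) = f (Γ.edge a p) + m * (u - p) := by
  obtain ⟨S, hS, h⟩ := hf.2 a
  have hmem : (S \ {t})ᶜ ∈ nhds t :=
    (hS.subset Set.sdiff_subset).isClosed.isOpen_compl.mem_nhds (by simp)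
  obtain ⟨p, hp, hpS⟩ := mem_nhdsLE_iff_exists_mem_Ico_Ioc_subset ht.1 |>.1
    (mem_nhdsWithin_of_mem_nhds hmem)
  exact ⟨p, hp.2, h p t hp.1 hp.2.le ht.2 (Set.disjoint_left.2 fun s hs hs' =>
    hpS ⟨hs'.1, hs'.2.le⟩ ⟨hs, hs'.2.ne⟩)⟩

/-- A piecewise linear function whose slope on the edge `a` is constant is affine on `a`. -/
theorem IsPiecewiseZLinear.sub_eq_mul_length {f : Γ.Point → ℝ} (hf : Γ.IsPiecewiseZLinear f)
    (a : E) {s : ℝ} (hs : ∀ t ∈ Set.Ico 0 (Γ.length a), Γ.slopeToHead f a t = s) :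
    f (.vertex (Γ.head a)) - f (.vertex (Γ.tail a)) = s * Γ.length a := by
  have hcont : ContinuousOn (fun t => f (Γ.edge a t)) (Set.Icc 0 (Γ.length a)) :=
    continuousOn_iff_continuous_domRestrict.2 (hf.1.comp (continuous_edge a))
  have h := constant_of_has_deriv_right_zero (f := fun t => f (Γ.edge a t) - s * t)
    (hcont.sub (by fun_prop)) (fun t ht => by
      rw [← hasDerivWithinAt_Ioi_iff_Ici]
      have h1 := (hf.differentiableWithinAt_Ioi a ht.1 ht.2).hasDerivWithinAt
      have h2 : derivWithin (fun s => f (Γ.edge a s)) (Set.Ioi t) t = s := hs t ht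
      rw [h2] at h1
      simpa using h1.fun_sub ((hasDerivAt_id' t).const_mul s).hasDerivWithinAt)
    (Γ.length a) ⟨(Γ.length_pos a).le, le_rfl⟩
  simp only [edge_zero, edge_length, mul_zero, sub_zero] at h
  linarith

/-- Serves for `c = 1 / n`. Scalars pass through `derivWithin` without differentiability, so no
piecewise linearity is needed. -/
theorem divCoeff_const_mul [Fintype E] (c : ℝ) (f : Γ.Point → ℝ) (x : Γ.Point) :
    Γ.divCoeff (fun y => c * f y) x = c * Γ.divCoeff f x := by
  have hH : ∀ a t, Γ.slopeToHead (fun y => c * f y) a t = c * Γ.slopeToHead f a t :=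
    fun a t => derivWithin_const_mul_field c
  have hT : ∀ a t, Γ.slopeToTail (fun y => c * f y) a t = c * Γ.slopeToTail f a t :=
    fun a t => (congrArg Neg.neg (derivWithin_const_mul_field c)).trans (mul_neg _ _).symm
  cases x with
  | vertex v =>
    simp only [divCoeff, hH, hT, mul_neg, mul_add, Finset.mul_sum, mul_ite, mul_zero]
  | inner a t ht => simp only [divCoeff, hH, hT]; ring

/-- The divisor `x₁ + ⋯ + xₖ`, where `xᵢ` is the point `tᵢ` of the edge `eᵢ`. -/
noncomputable def sumEdge (Γ : MetricGraph V E) {k : ℕ} (e : Fin k → E) (t : Fin k → ℝ) :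
    Γ.Divisor := ∑ i, Finsupp.single (Γ.edge (e i) (t i)) 1

theorem degree_sumEdge {k : ℕ} (e : Fin k → E) (t : Fin k → ℝ) :
    Γ.degree (Γ.sumEdge e t) = k := by
  have h : ∀ D : Γ.Divisor, Γ.degree D = Finsupp.liftAddHom (fun _ => AddMonoidHom.id ℤ) D :=
    fun _ => rfl
  simp [h, sumEdge, map_sum]

theorem sumEdge_nonneg {k : ℕ} (e : Fin k → E) (t : Fin k → ℝ) : 0 ≤ Γ.sumEdge e t :=
  Finset.sum_nonneg fun _ _ => Finsupp.single_nonneg.2 zero_le_one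

theorem sumEdge_vertex {k : ℕ} {e : Fin k → E} {t : Fin k → ℝ}
    (ht : ∀ i, t i ∈ Set.Ioo 0 (Γ.length (e i))) (v : V) : Γ.sumEdge e t (.vertex v) = 0 := by
  classical
  rw [sumEdge, Finsupp.finsetSum_apply]
  exact Finset.sum_eq_zero fun i _ => by simp [edge_of_mem _ (ht i)]

theorem sumEdge_inner [DecidableEq E] {k : ℕ} {e : Fin k → E} {t : Fin k → ℝ}
    (ht : ∀ i, t i ∈ Set.Ioo 0 (Γ.length (e i))) (a : E) (u : ℝ)
    (hu : u ∈ Set.Ioo 0 (Γ.length a)) :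
    Γ.sumEdge e t (.inner a u hu) = ∑ i, if t i = u then (if e i = a then 1 else 0) else 0 := by
  classical
  rw [sumEdge, Finsupp.finsetSum_apply]
  refine Finset.sum_congr rfl fun i _ => ?_
  rw [edge_of_mem _ (ht i), Finsupp.single_apply]
  by_cases h1 : t i = u <;> by_cases h2 : e i = a <;> simp [h1, h2]

/-- The slopes along the edge `a` of a function `f` with divisor `n (D - D')`, where `D` and `D'`
are sums of points in the interiors of the edges `e₁, …, eₖ`. -/
theorem IsPiecewiseZLinear.exists_slopes [Fintype E] [DecidableEq E] {f : Γ.Point → ℝ}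
    (hf : Γ.IsPiecewiseZLinear f) {k : ℕ} {e : Fin k → E} {t t' : Fin k → ℝ}
    (ht : ∀ i, t i ∈ Set.Ioo 0 (Γ.length (e i))) (ht' : ∀ i, t' i ∈ Set.Ioo 0 (Γ.length (e i)))
    {n : ℕ} (hdiv : ∀ x, ((n • (Γ.sumEdge e t - Γ.sumEdge e t')) x : ℝ) = Γ.divCoeff f x) (a : E) :
    ∃ s : ℤ, Γ.slopeToHead f a 0 = s ∧ Γ.slopeToTail f a (Γ.length a) = -s ∧
      (a ∉ Set.range e → ∀ u ∈ Set.Ico 0 (Γ.length a), Γ.slopeToHead f a u = s) ∧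
      ∀ u ∈ Set.Ico 0 (Γ.length a), ∃ m : ℤ, Γ.slopeToHead f a u = s + n * m := by
  -- The slope jump is minus the divisor coefficient, so points of `D` on `a` weigh `-1` and points
  -- of `D'` weigh `1`.
  let w : Fin k ⊕ Fin k → ℤ := Sum.elim (fun i => if e i = a then -1 else 0)
    (fun i => if e i = a then 1 else 0)
  obtain ⟨s, hR, hL⟩ := exists_slope_eq_add_sum (Γ.length_pos a) (fun u hu => hf.exists_right a hu)
    (fun u hu => hf.exists_left a hu) (fun i => n * w i) (Sum.elim t t') (by
      intro u hu
      have h := hdiv (.inner a u hu)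
      simp only [Finsupp.smul_apply, Finsupp.sub_apply, sumEdge_inner ht, sumEdge_inner ht',
        divCoeff, slopeToHead, slopeToTail, nsmul_eq_mul] at h
      have h2 : derivWithin (fun s => f (Γ.edge a s)) (Set.Ioi u) u -
          derivWithin (fun s => f (Γ.edge a s)) (Set.Iio u) u = _ :=
        (by ring : _ = -(-(derivWithin (fun s => f (Γ.edge a s)) (Set.Ioi u) u +
          -derivWithin (fun s => f (Γ.edge a s)) (Set.Iio u) u))).trans (congrArg Neg.neg h.symm)
      rw [h2, Fintype.sum_sum_type]
      push_cast
      simp only [w, Sum.elim_inl, Sum.elim_inr]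
      rw [mul_sub, Finset.mul_sum, Finset.mul_sum, neg_sub, sub_eq_neg_add,
        ← Finset.sum_neg_distrib]
      congr 1
      · refine Finset.sum_congr rfl fun i _ => ?_
        by_cases h : t i = u <;> by_cases h' : e i = a <;> simp [h, h']
      · refine Finset.sum_congr rfl fun i _ => ?_
        by_cases h : t' i = u <;> simp [h])
  refine ⟨s, ?_, ?_, fun ha u hu => ?_, fun u hu => ?_⟩
  · refine (hR 0 ⟨le_rfl, Γ.length_pos a⟩).trans ?_
    rw [Finset.sum_eq_zero, add_zero]
    rintro (i | i) -
    · exact if_neg (not_le.2 (ht i).1)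
    · exact if_neg (not_le.2 (ht' i).1)
  -- At the head all points on `a` have been passed; those of index `i` in `D` and `D'` lie on the
  -- same edge and cancel.
  · rw [slopeToTail, hL _ ⟨Γ.length_pos a, le_rfl⟩, Fintype.sum_sum_type,
      ← Finset.sum_add_distrib, Finset.sum_eq_zero, add_zero]
    intro i _
    by_cases h : e i = a
    · simp [w, h, h ▸ (ht i).2, h ▸ (ht' i).2]
    · simp [w, h]
  · refine (hR u hu).trans ?_
    rw [Finset.sum_eq_zero, add_zero]
    have hne : ∀ i, e i ≠ a := fun i h => ha ⟨i, h⟩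
    rintro (i | i) - <;> simp [w, hne]
  · refine ⟨∑ i, if Sum.elim t t' i ≤ u then w i else 0, (hR u hu).trans ?_⟩
    push_cast
    rw [Finset.mul_sum]
    congr 1
    refine Finset.sum_congr rfl fun i _ => ?_
    split_ifs <;> simp

/-- If the edge lengths satisfy no integral linear relation, `{e₁, …, eₖ}` is independent in the
cographic matroid and its closure is acyclic, then two divisors supported on the open edges
`e₁, …, eₖ` that differ by torsion are linearly equivalent. -/
theorem sub_mem_principal_of_nsmul [Finite V] [Fintype E] {k : ℕ} {e : Fin k → E}
    (hind : (Γ.cographicMatroid Γ.connected).Indep (Set.range e))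
    (hacyc : Γ.IsAcyclic ((Γ.cographicMatroid Γ.connected).closure (Set.range e)))
    (hl : ∀ c : E → ℤ, ∑ a, c a * Γ.length a = 0 → c = 0) {t t' : Fin k → ℝ}
    (ht : ∀ i, t i ∈ Set.Ioo 0 (Γ.length (e i))) (ht' : ∀ i, t' i ∈ Set.Ioo 0 (Γ.length (e i)))
    {n : ℕ} (hn : 0 < n) (h : n • (Γ.sumEdge e t - Γ.sumEdge e t') ∈ Γ.principal) :
    Γ.sumEdge e t - Γ.sumEdge e t' ∈ Γ.principal := by
  classical
  obtain ⟨f, hf, hdiv⟩ := h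
  choose s hs0 hsL hsconst hsmod using hf.exists_slopes ht ht' hdiv
  have hs : s = 0 := by
    refine hacyc.circulation_eq_zero s (fun a ha => ?_) (fun v => ?_)
    · exact OrientedGraph.slope_eq_zero_of_notMem_closure Γ.connected hind hl
        (fun v => f (.vertex v)) s (fun a ha => hf.sub_eq_mul_length a (hsconst a ha)) ha
    · have hv := hdiv (.vertex v)
      simp only [Finsupp.smul_apply, Finsupp.sub_apply, sumEdge_vertex ht, sumEdge_vertex ht',
        divCoeff, hs0, hsL] at hv
      have hneg : (∑ a, if Γ.head a = v then -(s a : ℝ) else 0) =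
          -∑ a, if Γ.head a = v then (s a : ℝ) else 0 := by
        rw [← Finset.sum_neg_distrib]
        exact Finset.sum_congr rfl fun a _ => by split_ifs <;> simp
      rw [hneg] at hv
      have : (∑ a, if Γ.tail a = v then (s a : ℝ) else 0) =
          ∑ a, if Γ.head a = v then (s a : ℝ) else 0 := by
        simp only [sub_self, smul_zero, Int.cast_zero] at hv
        linarith
      exact_mod_cast this
  have hn' : (n : ℝ) ≠ 0 := Nat.cast_ne_zero.2 hn.ne'
  refine ⟨fun x => (n : ℝ)⁻¹ * f x, ⟨continuous_const.mul hf.1, fun a => ?_⟩, fun x => ?_⟩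
  · obtain ⟨S, hS, hSf⟩ := hf.2 a
    refine ⟨S, hS, fun p q hp hpq hq hd => ?_⟩
    -- A one-point segment is set aside: at `p = length a` no slope towards the head is available.
    rcases hpq.eq_or_lt with rfl | hlt
    · exact ⟨0, fun u hu => by simp [le_antisymm hu.2 hu.1]⟩
    obtain ⟨m, hm⟩ := hSf p q hp hpq hq hd
    obtain ⟨m', hm'⟩ := hsmod a p ⟨hp, hlt.trans_le hq⟩
    -- Both sides are the right slope at `p`; divisibility by `n` comes from `s = 0`.
    have hmm : (m : ℝ) = n * m' := by
      rw [← derivWithin_Ioi_eq_of_affine hlt hm]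
      simpa [hs, slopeToHead] using hm'
    refine ⟨m', fun u hu => ?_⟩
    simp only [hm u hu, hmm]
    field_simp
  · rw [divCoeff_const_mul, ← hdiv]
    simp [hn']

end MetricGraph

/-! ### Distinct classes have distinct torsion packets -/

theorem mainTheorem6 {V E : Type*} [Finite V] [Fintype E]
    (G : OrientedGraph V E) (hG : G.Connected) {k : ℕ} (e : Fin k → E)
    (hind : (G.cographicMatroid hG).Indep (Set.range e))
    (hacyc : G.IsAcyclic ((G.cographicMatroid hG).closure (Set.range e))) :
    ForVeryGeneral {l : E → ℝ | ∀ a, 0 < l a} fun l =>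
      ∀ c ∈ (G.withLengths hG l).effOpenCell e, ∀ c' ∈ (G.withLengths hG l).effOpenCell e,
        c ≠ c' →
          (G.withLengths hG l).torsionPacket k c ≠ (G.withLengths hG l).torsionPacket k c' := by
  refine ⟨_, isVeryGeneral_setOf_linearIndependent E, fun l hl => ?_⟩
  rintro c ⟨x, hx, rfl⟩ c' ⟨x', hx', rfl⟩ hne heq
  choose t ht htx using hx
  choose t' ht' htx' using hx'
  obtain rfl : (fun i => (G.withLengths hG l).edge (e i) (t i)) = x := funext htx
  obtain rfl : (fun i => (G.withLengths hG l).edge (e i) (t' i)) = x' := funext htx'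
  set Γ := G.withLengths hG l
  -- A class lies in its own packet, so equal packets make the difference of the two classes
  -- torsion.
  have hself : Γ.divisorClass (Γ.sumEdge e t) ∈ Γ.torsionPacket k (Γ.divisorClass (Γ.sumEdge e t)) :=
    ⟨⟨_, MetricGraph.sumEdge_nonneg e t, MetricGraph.degree_sumEdge e t, rfl⟩,
      ⟨0, by simp [MetricGraph.degree], (sub_self _).symm⟩, 1, one_pos, by simp⟩
  obtain ⟨-, -, n, hn, hzero⟩ : _ ∈ Γ.torsionPacket k (Γ.divisorClass (Γ.sumEdge e t')) :=
    (show _ = _ from heq) ▸ hself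
  have hmem : n • (Γ.sumEdge e t' - Γ.sumEdge e t) ∈ Γ.principal := by
    rw [← neg_sub, smul_neg, neg_mem_iff]
    exact (QuotientAddGroup.eq_zero_iff _).1 hzero
  refine hne (QuotientAddGroup.eq.2 ?_)
  rw [neg_add_eq_sub]
  exact MetricGraph.sub_mem_principal_of_nsmul (Γ := Γ) hind hacyc hl ht' ht hn hmem
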